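/- **Notation.** All Hilbert spaces are complex. For a contraction $T:\mathfrak H_1\to\mathfrak H_2$ put $D_T=(I-T^*T)^{1/2}$ and $\mathfrak D_T=\overline{\operatorname{ran}}\,D_T\subseteq\mathfrak H_1$; then $T^*$ maps $\mathfrak D_{T^*}$ into $\mathfrak D_T$, and the operator $$J_T=\begin{bmatrix}T& D_{T^*}\\ D_T&-T^*\end{bmatrix}:\mathfrak H_1\oplus\mathfrak D_{T^*}\to\mathfrak H_2\oplus\mathfrak D_T$$ is defined. Let $\mathbb D$ be the open unit disk and $\mathbf S(\mathfrak H_1,\mathfrak H_2)$ the Schur class: all holomorphic functions on $\mathbb D$ whose values are contractions from $\mathfrak H_1$ to $\mathfrak H_2$. *Schur parameters.* Let $\Theta\in\mathbf S(\mathfrak M,\mathfrak N)$, and write $\mathfrak D_{\Gamma_{-1}}=\mathfrak M$, $\mathfrak D_{\Gamma_{-1}^*}=\mathfrak N$. The Schur iterates $\Theta_n\in\mathbf S(\mathfrak D_{\Gamma_{n-1}},\mathfrak D_{\Gamma_{n-1}^*})$ and the Schur parameters $\Gamma_n$ of $\Theta$ are given by $\Theta_0=\Theta$, $\Gamma_n=\Theta_n(0)$,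 and $$\Theta_n(\lambda)=\Gamma_n+\lambda D_{\Gamma_n^*}\Theta_{n+1}(\lambda)\bigl(I+\lambda\Gamma_n^*\Theta_{n+1}(\lambda)\bigr)^{-1}D_{\Gamma_n},\qquad \lambda\in\mathbb D,\ n\ge 0,$$ that is, $\lambda\Theta_{n+1}(\lambda)$ is the Möbius parameter of $\Theta_n$. If some $\Gamma_N$ is unitary, the sequences are continued by operators between zero spaces. *Systems.* A system $\{U;\mathfrak U,\mathfrak Y,\mathfrak H\}$ with input space $\mathfrak U$, output space $\mathfrak Y$ and state space $\mathfrak H$ is a block operator $U=\begin{bmatrix}D&C\\B&A\end{bmatrix}:\mathfrak U\oplus\mathfrak H\to\mathfrak Y\oplus\mathfrak H$. It is conservative if $U$ is unitary, and simple if the linear span of the ranges of $A^nB$ and of $A^{*n}C^*$, $n\ge 0$, is dense in $\mathfrak H$. Its transfer function is $D+\lambda C(I-\lambda A)^{-1}B$, $\lambda\in\mathbb D$; a realization of $\Theta$ is a system whose transfer function is $\Theta$. *Block operator CMV matrices.* For $k\ge 0$ define $$\mathfrak H_0(\{\Gamma_n\}_{n\ge k})=\bigoplus_{n\ge 0}\bigl(\mathfrak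 D_{\Gamma_{k+2n}}\oplus\mathfrak D_{\Gamma_{k+2n+1}^*}\bigr),\qquad \widetilde{\mathfrak H}_0(\{\Gamma_n\}_{n\ge k})=\bigoplus_{n\ge 0}\bigl(\mathfrak D_{\Gamma_{k+2n}^*}\oplus\mathfrak D_{\Gamma_{k+2n+1}}\bigr),$$ $$\mathcal L_0=J_{\Gamma_k}\oplus J_{\Gamma_{k+2}}\oplus\cdots:\ \mathfrak D_{\Gamma_{k-1}}\oplus\widetilde{\mathfrak H}_0\to\mathfrak D_{\Gamma_{k-1}^*}\oplus\mathfrak H_0,\qquad \mathcal V_0=J_{\Gamma_{k+1}}\oplus J_{\Gamma_{k+3}}\oplus\cdots:\ \mathfrak H_0\to\widetilde{\mathfrak H}_0,$$ $$\mathcal M_0=I_{\mathfrak D_{\Gamma_{k-1}}}\oplus\mathcal V_0,\qquad \widetilde{\mathcal M}_0=I_{\mathfrak D_{\Gamma_{k-1}^*}}\oplus\mathcal V_0,$$ $$\mathcal U_0(\{\Gamma_n\}_{n\ge k})=\mathcal L_0\mathcal M_0:\ \mathfrak D_{\Gamma_{k-1}}\oplus\mathfrak H_0\to\mathfrak D_{\Gamma_{k-1}^*}\oplus\mathfrak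 H_0,\qquad \widetilde{\mathcal U}_0(\{\Gamma_n\}_{n\ge k})=\widetilde{\mathcal M}_0\mathcal L_0:\ \mathfrak D_{\Gamma_{k-1}}\oplus\widetilde{\mathfrak H}_0\to\mathfrak D_{\Gamma_{k-1}^*}\oplus\widetilde{\mathfrak H}_0.$$ **Theorem 5.3.** Let $\mathfrak M,\mathfrak N$ be Hilbert spaces, let $\Theta\in\mathbf S(\mathfrak M,\mathfrak N)$, and let $\{\Gamma_n\}_{n\ge 0}$ be the Schur parameters and $\{\Theta_n\}_{n\ge 0}$ the Schur iterates of $\Theta$. Then the systems $$\zeta_0=\{\mathcal U_0(\{\Gamma_n\}_{n\ge 0});\mathfrak M,\mathfrak N,\mathfrak H_0(\{\Gamma_n\}_{n\ge 0})\},\qquad \widetilde\zeta_0=\{\widetilde{\mathcal U}_0(\{\Gamma_n\}_{n\ge 0});\mathfrak M,\mathfrak N,\widetilde{\mathfrak H}_0(\{\Gamma_n\}_{n\ge 0})\}$$ are simple conservative realizations of $\Theta$. Moreover, for every $k\ge 0$ the systems $$\{\mathcal U_0(\{\Gamma_n\}_{n\ge k});\mathfrak D_{\Gamma_{k-1}},\mathfrak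 D_{\Gamma_{k-1}^*},\mathfrak H_0(\{\Gamma_n\}_{n\ge k})\},\qquad \{\widetilde{\mathcal U}_0(\{\Gamma_n\}_{n\ge k});\mathfrak D_{\Gamma_{k-1}},\mathfrak D_{\Gamma_{k-1}^*},\widetilde{\mathfrak H}_0(\{\Gamma_n\}_{n\ge k})\}$$ are conservative and simple, and the transfer function of each of them is the $k$-th Schur iterate $\Theta_k$. -/

import Mathlib

open scoped ENNReal

noncomputable section

namespace BlockCMV

section Defect

variable {E F : Type*} [NormedAddCommGroup E] [InnerProductSpace ℂ E] [CompleteSpace E]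
  [NormedAddCommGroup F] [InnerProductSpace ℂ F] [CompleteSpace F]

/-- The adjoint `T*` of a bounded operator between Hilbert spaces. -/
abbrev adj (T : E →L[ℂ] F) : F →L[ℂ] E := ContinuousLinearMap.adjoint T

/-- The defect operator `D_T = (I - T* T)^{1/2}` of a contraction `T`. -/
def defectOp (T : E →L[ℂ] F) : E →L[ℂ] E := CFC.sqrt (1 - adj T ∘L T)

/-- The defect subspace `𝔇_T`, the closure of the range of `D_T`. -/
def defectSpace (T : E →L[ℂ] F) : Submodule ℂ E :=
  (LinearMap.range (defectOp T).toLinearMap).topologicalClosure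

theorem isClosed_defectSpace (T : E →L[ℂ] F) : IsClosed (defectSpace T : Set E) :=
  Submodule.isClosed_topologicalClosure _

instance (T : E →L[ℂ] F) : CompleteSpace (defectSpace T) :=
  (isClosed_defectSpace T).completeSpace_coe

theorem defectOp_mem (T : E →L[ℂ] F) (x : E) : defectOp T x ∈ defectSpace T :=
  Submodule.le_topologicalClosure _ ⟨x, rfl⟩

/-- `D_T` as an operator from the whole space to `𝔇_T`. -/
def defectTo (T : E →L[ℂ] F) : E →L[ℂ] defectSpace T :=
  (defectOp T).codRestrict (defectSpace T) (defectOp_mem T)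

/-- `D_T` restricted to `𝔇_T`, as an operator from `𝔇_T` to the whole space. -/
def defectFrom (T : E →L[ℂ] F) : defectSpace T →L[ℂ] E :=
  defectOp T ∘L (defectSpace T).subtypeL

/-- `T*` restricted to `𝔇_{T*}`, as an operator from `𝔇_{T*}` to `𝔇_T`. The orthogonal projection
onto `𝔇_T` only restricts the codomain: for a contraction `T*` maps `𝔇_{T*}` into `𝔇_T`, see
`coe_adjRestrict`. -/
def adjRestrict (T : E →L[ℂ] F) : defectSpace (adj T) →L[ℂ] defectSpace T :=
  (defectSpace T).orthogonalProjectionOnto ∘L adj T ∘L (defectSpace (adj T)).subtypeL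

theorem one_sub_nonneg {T : E →L[ℂ] F} (hT : ‖T‖ ≤ 1) : 0 ≤ 1 - adj T ∘L T := by
  rw [ContinuousLinearMap.nonneg_iff_isPositive, ContinuousLinearMap.isPositive_def]
  refine ⟨?_, fun x => ?_⟩
  · rw [← ContinuousLinearMap.isSelfAdjoint_iff_isSymmetric]
    exact (IsSelfAdjoint.one _).sub (ContinuousLinearMap.isPositive_adjoint_comp_self T).isSelfAdjoint
  · have h1 : ‖T x‖ ≤ ‖x‖ := by simpa using T.le_of_opNorm_le hT x
    have h2 : ‖T x‖ ^ 2 ≤ ‖x‖ ^ 2 := by gcongr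
    simp only [ContinuousLinearMap.reApplyInnerSelf_apply, sub_apply,
      one_apply_eq_self, ContinuousLinearMap.comp_apply, inner_sub_left,
      ContinuousLinearMap.adjoint_inner_left, map_sub, inner_self_eq_norm_sq]
    linarith

theorem defectOp_mul_self {T : E →L[ℂ] F} (hT : ‖T‖ ≤ 1) :
    defectOp T * defectOp T = 1 - adj T ∘L T :=
  CFC.sqrt_mul_sqrt_self _ (one_sub_nonneg hT)

theorem isSelfAdjoint_defectOp (T : E →L[ℂ] F) : IsSelfAdjoint (defectOp T) :=
  (CFC.sqrt_nonneg (1 - adj T ∘L T)).isSelfAdjoint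

theorem defectOp_inner (T : E →L[ℂ] F) (x y : E) :
    inner ℂ (defectOp T x) y = inner ℂ x (defectOp T y) := by
  have h := isSelfAdjoint_defectOp T
  rw [ContinuousLinearMap.isSelfAdjoint_iff_isSymmetric] at h
  exact h x y

theorem norm_defectOp_apply_sq {T : E →L[ℂ] F} (hT : ‖T‖ ≤ 1) (x : E) :
    ‖defectOp T x‖ ^ 2 = ‖x‖ ^ 2 - ‖T x‖ ^ 2 := by
  have h : defectOp T (defectOp T x) = x - adj T (T x) :=
    congrArg (fun S : E →L[ℂ] E => S x) (defectOp_mul_self hT)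
  rw [← inner_self_eq_norm_sq (𝕜 := ℂ) (defectOp T x), defectOp_inner, h, inner_sub_right,
    ContinuousLinearMap.adjoint_inner_right, map_sub, inner_self_eq_norm_sq,
    inner_self_eq_norm_sq]

theorem norm_defectOp_le {T : E →L[ℂ] F} (hT : ‖T‖ ≤ 1) : ‖defectOp T‖ ≤ 1 := by
  refine ContinuousLinearMap.opNorm_le_bound _ zero_le_one fun x => ?_
  have h := norm_defectOp_apply_sq hT x
  rw [one_mul]
  exact le_of_sq_le_sq (by nlinarith [sq_nonneg ‖T x‖]) (norm_nonneg _)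

theorem norm_adj_le {T : E →L[ℂ] F} (hT : ‖T‖ ≤ 1) : ‖adj T‖ ≤ 1 := by
  simpa [adj] using hT

theorem adj_mem_defectSpace {T : E →L[ℂ] F} (hT : ‖T‖ ≤ 1) {y : F}
    (hy : y ∈ defectSpace (adj T)) : adj T y ∈ defectSpace T := by
  rw [← Submodule.orthogonal_orthogonal (defectSpace T), Submodule.mem_orthogonal]
  intro x hx
  have hx0 : defectOp T x = 0 := by
    rw [Submodule.mem_orthogonal'] at hx
    have := hx _ (defectOp_mem T (defectOp T x))
    rw [← defectOp_inner] at this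
    exact inner_self_eq_zero.1 this
  have hTx : defectOp (adj T) (T x) = 0 := by
    have h1 : defectOp T (defectOp T x) = x - adj T (T x) :=
      congrArg (fun S : E →L[ℂ] E => S x) (defectOp_mul_self hT)
    have h2 : defectOp (adj T) (defectOp (adj T) (T x)) = T x - T (adj T (T x)) := by
      have := congrArg (fun S : F →L[ℂ] F => S (T x)) (defectOp_mul_self (norm_adj_le hT))
      simpa [adj] using this
    rw [hx0, map_zero] at h1
    rw [← map_sub, ← h1, map_zero] at h2
    have h3 : inner ℂ (T x) (defectOp (adj T) (defectOp (adj T) (T x))) = (0 : ℂ) := by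
      rw [h2, inner_zero_right]
    rw [← defectOp_inner] at h3
    exact inner_self_eq_zero.1 h3
  rw [ContinuousLinearMap.adjoint_inner_right]
  have hker : defectSpace (adj T) ≤ (ℂ ∙ T x)ᗮ := by
    refine Submodule.topologicalClosure_minimal _ ?_ (Submodule.isClosed_orthogonal _)
    rintro _ ⟨z, rfl⟩
    rw [Submodule.mem_orthogonal_singleton_iff_inner_right]
    change inner ℂ (T x) (defectOp (adj T) z) = 0
    rw [← defectOp_inner, hTx, inner_zero_left]
  exact Submodule.mem_orthogonal_singleton_iff_inner_right.1 (hker hy)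

/-- For a contraction, `adjRestrict T` acts as `T*`. -/
theorem coe_adjRestrict {T : E →L[ℂ] F} (hT : ‖T‖ ≤ 1) (y : defectSpace (adj T)) :
    (adjRestrict T y : E) = adj T y :=
  congrArg Subtype.val
    (Submodule.orthogonalProjectionOnto_mem_subspace_eq_self
      (⟨adj T y, adj_mem_defectSpace hT y.2⟩ : defectSpace T))

end Defect

section Blocks

variable {A B C D : Type*}
  [NormedAddCommGroup A] [InnerProductSpace ℂ A] [NormedAddCommGroup B] [InnerProductSpace ℂ B]
  [NormedAddCommGroup C] [InnerProductSpace ℂ C] [NormedAddCommGroup D] [InnerProductSpace ℂ D]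

/-- The operator with block matrix `[a b; c d]` from the Hilbert space sum `A ⊕ B` to the Hilbert
space sum `C ⊕ D`. -/
def blockOp (a : A →L[ℂ] C) (b : B →L[ℂ] C) (c : A →L[ℂ] D) (d : B →L[ℂ] D) :
    WithLp 2 (A × B) →L[ℂ] WithLp 2 (C × D) :=
  (WithLp.prodContinuousLinearEquiv 2 ℂ C D).symm.toContinuousLinearMap ∘L
    ((a.coprod b).prod (c.coprod d)) ∘L
    (WithLp.prodContinuousLinearEquiv 2 ℂ A B).toContinuousLinearMap

/-- The diagonal operator `a ⊕ d`. -/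
abbrev diagOp (a : A →L[ℂ] C) (d : B →L[ℂ] D) : WithLp 2 (A × B) →L[ℂ] WithLp 2 (C × D) :=
  blockOp a 0 0 d

theorem blockOp_apply (a : A →L[ℂ] C) (b : B →L[ℂ] C) (c : A →L[ℂ] D) (d : B →L[ℂ] D)
    (x : WithLp 2 (A × B)) :
    blockOp a b c d x = WithLp.toLp 2 (a x.fst + b x.snd, c x.fst + d x.snd) := rfl

theorem norm_blockOp_le {a : A →L[ℂ] C} {b : B →L[ℂ] C} {c : A →L[ℂ] D} {d : B →L[ℂ] D}
    (ha : ‖a‖ ≤ 1) (hb : ‖b‖ ≤ 1) (hc : ‖c‖ ≤ 1) (hd : ‖d‖ ≤ 1) : ‖blockOp a b c d‖ ≤ 2 := by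
  refine ContinuousLinearMap.opNorm_le_bound _ zero_le_two fun x => ?_
  have h1 : ‖a x.fst + b x.snd‖ ≤ ‖x.fst‖ + ‖x.snd‖ :=
    (norm_add_le _ _).trans (add_le_add (by simpa using a.le_of_opNorm_le ha x.fst)
      (by simpa using b.le_of_opNorm_le hb x.snd))
  have h2 : ‖c x.fst + d x.snd‖ ≤ ‖x.fst‖ + ‖x.snd‖ :=
    (norm_add_le _ _).trans (add_le_add (by simpa using c.le_of_opNorm_le hc x.fst)
      (by simpa using d.le_of_opNorm_le hd x.snd))
  have h3 := WithLp.prod_norm_sq_eq_of_L2 x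
  have h4 := WithLp.prod_norm_sq_eq_of_L2 (blockOp a b c d x)
  rw [blockOp_apply] at h4 ⊢
  simp only [WithLp.toLp_fst, WithLp.toLp_snd] at h4
  have h5 : ‖a x.fst + b x.snd‖ ^ 2 ≤ (‖x.fst‖ + ‖x.snd‖) ^ 2 := by gcongr
  have h6 : ‖c x.fst + d x.snd‖ ^ 2 ≤ (‖x.fst‖ + ‖x.snd‖) ^ 2 := by gcongr
  refine le_of_sq_le_sq ?_ (by positivity)
  nlinarith [sq_nonneg (‖x.fst‖ - ‖x.snd‖)]

end Blocks

section Rotation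

variable {E F : Type*} [NormedAddCommGroup E] [InnerProductSpace ℂ E] [CompleteSpace E]
  [NormedAddCommGroup F] [InnerProductSpace ℂ F] [CompleteSpace F]

/-- The elementary rotation `J_T = [T D_{T*}; D_T -T*] : E ⊕ 𝔇_{T*} → F ⊕ 𝔇_T`. If `T` is isometric
then `𝔇_T = 0` and `D_{T*}` is the identity on `𝔇_{T*}`, so this is the row `[T I]`; if `T` is
co-isometric then `𝔇_{T*} = 0` and it is the column `[T; D_T]`; if `T` is unitary it is `T`. -/
def rotation (T : E →L[ℂ] F) :
    WithLp 2 (E × defectSpace (adj T)) →L[ℂ] WithLp 2 (F × defectSpace T) :=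
  blockOp T (defectFrom (adj T)) (defectTo T) (-adjRestrict T)

theorem norm_rotation_le {T : E →L[ℂ] F} (hT : ‖T‖ ≤ 1) : ‖rotation T‖ ≤ 2 := by
  refine norm_blockOp_le hT ?_ ?_ ?_
  · refine ContinuousLinearMap.opNorm_le_bound _ zero_le_one fun x => ?_
    exact (defectOp (adj T)).le_of_opNorm_le (norm_defectOp_le (norm_adj_le hT)) x
  · refine ContinuousLinearMap.opNorm_le_bound _ zero_le_one fun x => ?_
    exact (defectOp T).le_of_opNorm_le (norm_defectOp_le hT) x
  · rw [norm_neg]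
    refine ContinuousLinearMap.opNorm_le_bound _ zero_le_one fun x => ?_
    change ‖(adjRestrict T x : E)‖ ≤ _
    rw [coe_adjRestrict hT]
    exact (adj T).le_of_opNorm_le (norm_adj_le hT) x

end Rotation

section Sums

/-- The Hilbert space sum `⨁ₙ (A n ⊕ B n)`. -/
abbrev PairSum (A : ℕ → Type*) (B : ℕ → Type*) [∀ n, NormedAddCommGroup (A n)]
    [∀ n, NormedAddCommGroup (B n)] : Type _ :=
  lp (fun n => WithLp 2 (A n × B n)) 2

theorem memlp_two_iff {G : ℕ → Type*} [∀ n, NormedAddCommGroup (G n)] {f : ∀ n, G n} :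
    Memℓp f 2 ↔ Summable fun n => ‖f n‖ ^ 2 := by
  rw [memℓp_gen_iff (by norm_num)]
  simp

theorem norm_sq_lp_two {G : ℕ → Type*} [∀ n, NormedAddCommGroup (G n)] (f : lp G 2) :
    ‖f‖ ^ 2 = ∑' n, ‖f n‖ ^ 2 := by
  have h := lp.norm_rpow_eq_tsum (p := 2) (by norm_num) f
  simpa using h

variable {P Q : ℕ → Type*} [∀ n, NormedAddCommGroup (P n)] [∀ n, NormedAddCommGroup (Q n)]

/-- The vector `((p₀, q₀), (p₁, q₁), …)` made of `p₀` and `((q₀, p₁), (q₁, p₂), …)`. -/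
def regroupFun (x : WithLp 2 (P 0 × PairSum Q (fun n => P (n + 1)))) :
    ∀ n, WithLp 2 (P n × Q n)
  | 0 => WithLp.toLp 2 (x.fst, (x.snd 0).fst)
  | n + 1 => WithLp.toLp 2 ((x.snd n).snd, (x.snd (n + 1)).fst)

theorem summable_pair (y : PairSum P Q) :
    (Summable fun n => ‖(y n).fst‖ ^ 2) ∧ Summable fun n => ‖(y n).snd‖ ^ 2 := by
  have h := memlp_two_iff.1 (lp.memℓp y)
  refine ⟨h.of_nonneg_of_le (fun n => by positivity) fun n => ?_,
    h.of_nonneg_of_le (fun n => by positivity) fun n => ?_⟩ <;>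
  rw [WithLp.prod_norm_sq_eq_of_L2] <;> linarith [sq_nonneg ‖(y n).fst‖, sq_nonneg ‖(y n).snd‖]

theorem memlp_regroupFun (x : WithLp 2 (P 0 × PairSum Q (fun n => P (n + 1)))) :
    Memℓp (regroupFun x) 2 := by
  obtain ⟨h1, h2⟩ := summable_pair x.snd
  rw [memlp_two_iff, ← summable_nat_add_iff 1]
  refine (h2.add ((summable_nat_add_iff 1).2 h1)).congr fun n => ?_
  rw [WithLp.prod_norm_sq_eq_of_L2]
  rfl

theorem memlp_regroupInv (y : PairSum P Q) :
    Memℓp (fun n => (WithLp.toLp 2 ((y n).snd, (y (n + 1)).fst) : WithLp 2 (Q n × P (n + 1)))) 2 := by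
  obtain ⟨h1, h2⟩ := summable_pair y
  rw [memlp_two_iff]
  refine (h2.add ((summable_nat_add_iff 1).2 h1)).congr fun n => ?_
  rw [WithLp.prod_norm_sq_eq_of_L2]
  rfl

variable [∀ n, InnerProductSpace ℂ (P n)] [∀ n, InnerProductSpace ℂ (Q n)]

/-- The regrouping of summands
`P 0 ⊕ ⨁ₙ (Q n ⊕ P (n + 1)) = ⨁ₙ (P n ⊕ Q n)`. -/
def regroup : WithLp 2 (P 0 × PairSum Q (fun n => P (n + 1))) ≃ₗᵢ[ℂ] PairSum P Q where
  toFun x := ⟨regroupFun x, memlp_regroupFun x⟩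
  invFun y := WithLp.toLp 2 ((y 0).fst,
    ⟨fun n => WithLp.toLp 2 ((y n).snd, (y (n + 1)).fst), memlp_regroupInv y⟩)
  map_add' x x' := by
    ext n
    cases n <;> rfl
  map_smul' c x := by
    ext n
    cases n <;> rfl
  left_inv x := by
    apply (WithLp.equiv 2 _).injective
    refine Prod.ext rfl ?_
    ext n
    cases n <;> rfl
  right_inv y := by
    ext n
    cases n <;> rfl
  norm_map' x := by
    obtain ⟨h1, h2⟩ := summable_pair x.snd
    have hs := memlp_two_iff.1 (memlp_regroupFun x)
    have key : ‖(⟨regroupFun x, memlp_regroupFun x⟩ : PairSum P Q)‖ ^ 2 = ‖x‖ ^ 2 := by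
      rw [norm_sq_lp_two, WithLp.prod_norm_sq_eq_of_L2, norm_sq_lp_two, hs.tsum_eq_zero_add]
      have e1 : ∀ n, ‖regroupFun x (n + 1)‖ ^ 2
          = ‖(x.snd n).snd‖ ^ 2 + ‖(x.snd (n + 1)).fst‖ ^ 2 := fun n => by
        rw [WithLp.prod_norm_sq_eq_of_L2]; rfl
      have e2 : ∀ n, ‖x.snd n‖ ^ 2 = ‖(x.snd n).fst‖ ^ 2 + ‖(x.snd n).snd‖ ^ 2 := fun n =>
        WithLp.prod_norm_sq_eq_of_L2 _
      have e0 : ‖regroupFun x 0‖ ^ 2 = ‖x.fst‖ ^ 2 + ‖(x.snd 0).fst‖ ^ 2 := by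
        rw [WithLp.prod_norm_sq_eq_of_L2]; rfl
      have e3 := h1.tsum_eq_zero_add
      change ‖regroupFun x 0‖ ^ 2 + ∑' n, ‖regroupFun x (n + 1)‖ ^ 2
        = ‖x.fst‖ ^ 2 + ∑' n, ‖x.snd n‖ ^ 2
      simp only [e1, e2, e0]
      rw [h2.tsum_add ((summable_nat_add_iff 1).2 h1), h1.tsum_add h2, e3]
      ring
    exact (sq_eq_sq₀ (norm_nonneg _) (norm_nonneg _)).1 key

end Sums

section Systems

variable {U Y H : Type*} [NormedAddCommGroup U] [InnerProductSpace ℂ U] [CompleteSpace U]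
  [NormedAddCommGroup Y] [InnerProductSpace ℂ Y] [CompleteSpace Y]
  [NormedAddCommGroup H] [InnerProductSpace ℂ H] [CompleteSpace H]

/-- A discrete time-invariant linear system with input space `U`, output space `Y` and state space
`H`, given by the block operator `[D C; B A] : U ⊕ H → Y ⊕ H`. -/
structure LinearSystem (U Y H : Type*) [NormedAddCommGroup U] [InnerProductSpace ℂ U]
    [NormedAddCommGroup Y] [InnerProductSpace ℂ Y]
    [NormedAddCommGroup H] [InnerProductSpace ℂ H] where
  /-- the block operator of the system -/
  op : WithLp 2 (U × H) →L[ℂ] WithLp 2 (Y × H)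

namespace LinearSystem

/-- The embedding of the first summand. -/
def inlL (U H : Type*) [NormedAddCommGroup U] [InnerProductSpace ℂ U]
    [NormedAddCommGroup H] [InnerProductSpace ℂ H] : U →L[ℂ] WithLp 2 (U × H) :=
  (WithLp.prodContinuousLinearEquiv 2 ℂ U H).symm.toContinuousLinearMap ∘L
    ContinuousLinearMap.inl ℂ U H

/-- The embedding of the second summand. -/
def inrL (U H : Type*) [NormedAddCommGroup U] [InnerProductSpace ℂ U]
    [NormedAddCommGroup H] [InnerProductSpace ℂ H] : H →L[ℂ] WithLp 2 (U × H) :=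
  (WithLp.prodContinuousLinearEquiv 2 ℂ U H).symm.toContinuousLinearMap ∘L
    ContinuousLinearMap.inr ℂ U H

variable (τ : LinearSystem U Y H)

/-- The feedthrough operator `D`. -/
def feedthrough : U →L[ℂ] Y := WithLp.fstL 2 ℂ Y H ∘L τ.op ∘L inlL U H

/-- The observation operator `C`. -/
def observation : H →L[ℂ] Y := WithLp.fstL 2 ℂ Y H ∘L τ.op ∘L inrL U H

/-- The control operator `B`. -/
def control : U →L[ℂ] H := WithLp.sndL 2 ℂ Y H ∘L τ.op ∘L inlL U H

/-- The state space operator `A`. -/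
def state : H →L[ℂ] H := WithLp.sndL 2 ℂ Y H ∘L τ.op ∘L inrL U H

/-- The system is conservative if its block operator is unitary. -/
def IsConservative : Prop := adj τ.op ∘L τ.op = 1 ∧ τ.op ∘L adj τ.op = 1

/-- The controllable subspace, the closed linear span of the ranges of `A ^ n B`. -/
def controllable : Submodule ℂ H :=
  (⨆ n : ℕ, LinearMap.range ((τ.state ^ n) ∘L τ.control).toLinearMap).topologicalClosure

/-- The observable subspace, the closed linear span of the ranges of `(A*) ^ n C*`. -/
def observable : Submodule ℂ H :=
  (⨆ n : ℕ, LinearMap.range ((adj τ.state ^ n) ∘L adj τ.observation).toLinearMap).topologicalClosure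

/-- The system is simple if the sum of the controllable and the observable subspace is dense. -/
def IsSimple : Prop := (τ.controllable ⊔ τ.observable).topologicalClosure = ⊤

/-- The transfer function `D + z C (I - z A)⁻¹ B`. For a conservative system `A` is a contraction,
so the inverse exists for every `z` in the open unit disk. -/
def transfer (z : ℂ) : U →L[ℂ] Y :=
  τ.feedthrough + z • (τ.observation ∘L Ring.inverse (1 - z • τ.state) ∘L τ.control)

end LinearSystem

end Systems

section Schur

variable {E F : Type*} [NormedAddCommGroup E] [InnerProductSpace ℂ E] [CompleteSpace E]
  [NormedAddCommGroup F] [InnerProductSpace ℂ F] [CompleteSpace F]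

/-- The Schur class `S(E, F)`: holomorphic functions on the open unit disk whose values are
contractions from `E` to `F`. -/
def IsSchur (Θ : ℂ → E →L[ℂ] F) : Prop :=
  DifferentiableOn ℂ Θ (Metric.ball 0 1) ∧ ∀ z ∈ Metric.ball (0 : ℂ) 1, ‖Θ z‖ ≤ 1

/-- `Z` is the Möbius parameter of `Θ`, where `T = Θ(0)`: `Z` is in the Schur class
`S(𝔇_T, 𝔇_{T*})` and `Θ(z) = T + D_{T*} Z(z) (I + T* Z(z))⁻¹ D_T` on the unit disk. -/
def IsMobiusParameter (Θ : ℂ → E →L[ℂ] F) (T : E →L[ℂ] F)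
    (Z : ℂ → defectSpace T →L[ℂ] defectSpace (adj T)) : Prop :=
  Θ 0 = T ∧ IsSchur Z ∧ ∀ z ∈ Metric.ball (0 : ℂ) 1,
    IsUnit (1 + adjRestrict T ∘L Z z) ∧
    Θ z = T + defectFrom (adj T) ∘L Z z ∘L Ring.inverse (1 + adjRestrict T ∘L Z z) ∘L defectTo T

end Schur

section Tower

universe u
variable {M : Type u} [NormedAddCommGroup M] [InnerProductSpace ℂ M]

/-- The sequence of Hilbert spaces `M, 𝔇 0, 𝔇 1, 𝔇 2, …` for closed subspaces `𝔇 n` of `M`. -/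
def Tower (𝔇 : ℕ → ClosedSubmodule ℂ M) : ℕ → Type u
  | 0 => M
  | n + 1 => (𝔇 n).toSubmodule

namespace Tower

variable (𝔇 : ℕ → ClosedSubmodule ℂ M)

instance instNormed : ∀ n, NormedAddCommGroup (Tower 𝔇 n)
  | 0 => inferInstanceAs (NormedAddCommGroup M)
  | n + 1 => inferInstanceAs (NormedAddCommGroup (𝔇 n).toSubmodule)

instance instInner : ∀ n, InnerProductSpace ℂ (Tower 𝔇 n)
  | 0 => inferInstanceAs (InnerProductSpace ℂ M)
  | n + 1 => inferInstanceAs (InnerProductSpace ℂ (𝔇 n).toSubmodule)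

instance instComplete [CompleteSpace M] : ∀ n, CompleteSpace (Tower 𝔇 n)
  | 0 => inferInstanceAs (CompleteSpace M)
  | n + 1 => (𝔇 n).isClosed.completeSpace_coe

/-- The inclusion of each space of the sequence into `M`. -/
def incl : ∀ n, Tower 𝔇 n →ₗᵢ[ℂ] M
  | 0 => LinearIsometry.id
  | n + 1 => (𝔇 n).toSubmodule.subtypeₗᵢ

end Tower

end Tower

section Choice

universe u v

/-- A choice sequence of contractions `Γ 0 : M → N`, `Γ n : 𝔇_{Γ (n-1)} → 𝔇_{Γ (n-1)*}` for
`n ≥ 1`. As each `𝔇_{Γ n}` is a closed subspace of the domain of `Γ n`, all these spaces are closed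
subspaces of `M`; `dom n` is `𝔇_{Γ n}` as a subspace of `M`, and `cod n` is `𝔇_{Γ n*}` as a subspace
of `N`. -/
structure ChoiceSequence (M : Type u) (N : Type v)
    [NormedAddCommGroup M] [InnerProductSpace ℂ M] [CompleteSpace M]
    [NormedAddCommGroup N] [InnerProductSpace ℂ N] [CompleteSpace N] where
  /-- `dom n = 𝔇_{Γ n}` -/
  dom : ℕ → ClosedSubmodule ℂ M
  /-- `cod n = 𝔇_{Γ n*}` -/
  cod : ℕ → ClosedSubmodule ℂ N
  /-- the operators of the sequence -/
  op : ∀ n, Tower dom n →L[ℂ] Tower cod n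
  norm_op_le : ∀ n, ‖op n‖ ≤ 1
  map_dom : ∀ n, (defectSpace (op n)).map (Tower.incl dom n).toLinearMap = (dom n).toSubmodule
  map_cod : ∀ n, (defectSpace (adj (op n))).map (Tower.incl cod n).toLinearMap = (cod n).toSubmodule

namespace ChoiceSequence

variable {M : Type u} {N : Type v}
  [NormedAddCommGroup M] [InnerProductSpace ℂ M] [CompleteSpace M]
  [NormedAddCommGroup N] [InnerProductSpace ℂ N] [CompleteSpace N]
  (Γ : ChoiceSequence M N)

/-- `Γ.E 0 = M` and `Γ.E (n + 1) = 𝔇_{Γ n}`. -/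
abbrev E (n : ℕ) : Type u := Tower Γ.dom n

/-- `Γ.F 0 = N` and `Γ.F (n + 1) = 𝔇_{Γ n*}`. -/
abbrev F (n : ℕ) : Type v := Tower Γ.cod n

/-- An isometry carries a subspace onto its image. -/
def imageEquiv {X Y : Type*} [NormedAddCommGroup X] [InnerProductSpace ℂ X]
    [NormedAddCommGroup Y] [InnerProductSpace ℂ Y] (i : X →ₗᵢ[ℂ] Y) (p : Submodule ℂ X) :
    p ≃ₗᵢ[ℂ] p.map i.toLinearMap :=
  LinearIsometryEquiv.ofSurjective (i.submoduleMap p) (i.toLinearMap.submoduleMap_surjective p)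

/-- The identity of `𝔇_{Γ n}`, seen as a subspace of `Γ.E n`, with `𝔇_{Γ n}`, seen as a subspace
of `M`. -/
def identE (n : ℕ) : defectSpace (Γ.op n) ≃ₗᵢ[ℂ] Γ.E (n + 1) :=
  (imageEquiv (Tower.incl Γ.dom n) (defectSpace (Γ.op n))).trans
    (LinearIsometryEquiv.ofEq _ _ (Γ.map_dom n))

/-- The identity of `𝔇_{Γ n*}`, seen as a subspace of `Γ.F n`, with `𝔇_{Γ n*}`, seen as a subspace
of `N`. -/
def identF (n : ℕ) : defectSpace (adj (Γ.op n)) ≃ₗᵢ[ℂ] Γ.F (n + 1) :=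
  (imageEquiv (Tower.incl Γ.cod n) (defectSpace (adj (Γ.op n)))).trans
    (LinearIsometryEquiv.ofEq _ _ (Γ.map_cod n))

theorem incl_identE (n : ℕ) (x : defectSpace (Γ.op n)) :
    Tower.incl Γ.dom (n + 1) (Γ.identE n x) = Tower.incl Γ.dom n x := rfl

theorem incl_identF (n : ℕ) (y : defectSpace (adj (Γ.op n))) :
    Tower.incl Γ.cod (n + 1) (Γ.identF n y) = Tower.incl Γ.cod n y := rfl

/-- The elementary rotation
`J_{Γ n} : 𝔇_{Γ (n-1)} ⊕ 𝔇_{Γ n*} → 𝔇_{Γ (n-1)*} ⊕ 𝔇_{Γ n}`. -/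
def rot (n : ℕ) : WithLp 2 (Γ.E n × Γ.F (n + 1)) →L[ℂ] WithLp 2 (Γ.F n × Γ.E (n + 1)) :=
  diagOp (ContinuousLinearMap.id ℂ (Γ.F n)) (Γ.identE n).toContinuousLinearEquiv.toContinuousLinearMap ∘L
    rotation (Γ.op n) ∘L
    diagOp (ContinuousLinearMap.id ℂ (Γ.E n))
      (Γ.identF n).symm.toContinuousLinearEquiv.toContinuousLinearMap

theorem norm_rot_le (n : ℕ) : ‖Γ.rot n‖ ≤ 8 := by
  have h1 : ‖diagOp (ContinuousLinearMap.id ℂ (Γ.F n))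
      (Γ.identE n).toContinuousLinearEquiv.toContinuousLinearMap‖ ≤ 2 :=
    norm_blockOp_le ContinuousLinearMap.norm_id_le (by simp) (by simp)
      (Γ.identE n).toLinearIsometry.norm_toContinuousLinearMap_le
  have h2 : ‖diagOp (ContinuousLinearMap.id ℂ (Γ.E n))
      (Γ.identF n).symm.toContinuousLinearEquiv.toContinuousLinearMap‖ ≤ 2 :=
    norm_blockOp_le ContinuousLinearMap.norm_id_le (by simp) (by simp)
      (Γ.identF n).symm.toLinearIsometry.norm_toContinuousLinearMap_le
  have h3 := norm_rotation_le (Γ.norm_op_le n)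
  have h4 : ‖rotation (Γ.op n) ∘L diagOp (ContinuousLinearMap.id ℂ (Γ.E n))
      (Γ.identF n).symm.toContinuousLinearEquiv.toContinuousLinearMap‖ ≤ 2 * 2 :=
    (ContinuousLinearMap.opNorm_comp_le _ _).trans
      (mul_le_mul h3 h2 (norm_nonneg _) zero_le_two)
  refine ((ContinuousLinearMap.opNorm_comp_le _ _).trans
    (mul_le_mul h1 h4 (norm_nonneg _) zero_le_two)).trans ?_
  norm_num

/-! In the following definitions the argument `k` stands for the passage from the choice sequence
`{Γ n}_{n ≥ 0}` to the choice sequence `{Γ n}_{n ≥ k}`. -/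

/-- The state space `H₀({Γ n}_{n ≥ k}) = ⨁ₙ (𝔇_{Γ (k+2n)} ⊕ 𝔇_{Γ (k+2n+1)*})`. -/
abbrev H (k : ℕ) : Type (max u v) :=
  PairSum (fun n => Γ.E (k + 2 * n + 1)) (fun n => Γ.F (k + 2 * (n + 1)))

/-- The state space `H̃₀({Γ n}_{n ≥ k}) = ⨁ₙ (𝔇_{Γ (k+2n)*} ⊕ 𝔇_{Γ (k+2n+1)})`. -/
abbrev Ht (k : ℕ) : Type (max u v) :=
  PairSum (fun n => Γ.F (k + 2 * n + 1)) (fun n => Γ.E (k + 2 * (n + 1)))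

/-- The block diagonal operator `⨁ₙ J_{Γ (k+2n)}`. -/
def evenRot (k : ℕ) :
    PairSum (fun n => Γ.E (k + 2 * n)) (fun n => Γ.F (k + 2 * n + 1)) →L[ℂ]
      PairSum (fun n => Γ.F (k + 2 * n)) (fun n => Γ.E (k + 2 * n + 1)) :=
  lp.mapCLM 2 (fun n => Γ.rot (k + 2 * n)) (by norm_num : (0 : ℝ) ≤ 8) fun _ => Γ.norm_rot_le _

/-- The operator `L₀({Γ n}_{n ≥ k}) = J_{Γ k} ⊕ J_{Γ (k+2)} ⊕ J_{Γ (k+4)} ⊕ ⋯` from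
`𝔇_{Γ (k-1)} ⊕ H̃₀` to `𝔇_{Γ (k-1)*} ⊕ H₀`. -/
def opL (k : ℕ) : WithLp 2 (Γ.E k × Γ.Ht k) →L[ℂ] WithLp 2 (Γ.F k × Γ.H k) :=
  (regroup (P := fun n => Γ.F (k + 2 * n))
      (Q := fun n => Γ.E (k + 2 * n + 1))).symm.toContinuousLinearEquiv.toContinuousLinearMap ∘L
    Γ.evenRot k ∘L
    (regroup (P := fun n => Γ.E (k + 2 * n))
      (Q := fun n => Γ.F (k + 2 * n + 1))).toContinuousLinearEquiv.toContinuousLinearMap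

/-- The operator `V₀({Γ n}_{n ≥ k}) = J_{Γ (k+1)} ⊕ J_{Γ (k+3)} ⊕ ⋯ : H₀ → H̃₀`. -/
def opV (k : ℕ) : Γ.H k →L[ℂ] Γ.Ht k :=
  lp.mapCLM 2 (fun n => Γ.rot (k + 2 * n + 1)) (by norm_num : (0 : ℝ) ≤ 8) fun _ => Γ.norm_rot_le _

/-- The operator `M₀({Γ n}_{n ≥ k}) = I ⊕ V₀` on `𝔇_{Γ (k-1)} ⊕ H₀`. -/
def opM (k : ℕ) : WithLp 2 (Γ.E k × Γ.H k) →L[ℂ] WithLp 2 (Γ.E k × Γ.Ht k) :=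
  diagOp (ContinuousLinearMap.id ℂ (Γ.E k)) (Γ.opV k)

/-- The operator `M̃₀({Γ n}_{n ≥ k}) = I ⊕ V₀` on `𝔇_{Γ (k-1)*} ⊕ H₀`. -/
def opMt (k : ℕ) : WithLp 2 (Γ.F k × Γ.H k) →L[ℂ] WithLp 2 (Γ.F k × Γ.Ht k) :=
  diagOp (ContinuousLinearMap.id ℂ (Γ.F k)) (Γ.opV k)

/-- The block operator CMV matrix `U₀({Γ n}_{n ≥ k}) = L₀ M₀`. -/
def cmv (k : ℕ) : WithLp 2 (Γ.E k × Γ.H k) →L[ℂ] WithLp 2 (Γ.F k × Γ.H k) :=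
  Γ.opL k ∘L Γ.opM k

/-- The block operator CMV matrix `Ũ₀({Γ n}_{n ≥ k}) = M̃₀ L₀`. -/
def cmvt (k : ℕ) : WithLp 2 (Γ.E k × Γ.Ht k) →L[ℂ] WithLp 2 (Γ.F k × Γ.Ht k) :=
  Γ.opMt k ∘L Γ.opL k

/-- The system `{U₀({Γ n}_{n ≥ k}); 𝔇_{Γ (k-1)}, 𝔇_{Γ (k-1)*}, H₀({Γ n}_{n ≥ k})}`. For `k = 0` the
input space is `M` and the output space is `N`. -/
def zeta (k : ℕ) : LinearSystem (Γ.E k) (Γ.F k) (Γ.H k) := ⟨Γ.cmv k⟩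

/-- The system `{Ũ₀({Γ n}_{n ≥ k}); 𝔇_{Γ (k-1)}, 𝔇_{Γ (k-1)*}, H̃₀({Γ n}_{n ≥ k})}`. For `k = 0` the
input space is `M` and the output space is `N`. -/
def zetat (k : ℕ) : LinearSystem (Γ.E k) (Γ.F k) (Γ.Ht k) := ⟨Γ.cmvt k⟩

/-- The operator Schur algorithm applied to `Θ` in `S(M, N)` produces the Schur iterates `Θs n` and
the Schur parameters `Γ n`: `Θs 0 = Θ`, `Θs n` is in the Schur class, `Γ n = Θs n 0`, and
`z ↦ z Θs (n + 1) z` is the Möbius parameter of `Θs n`. -/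
structure IsSchurAlgorithm (Θ : ℂ → M →L[ℂ] N) (Θs : ∀ n, ℂ → Γ.E n →L[ℂ] Γ.F n) : Prop where
  zero : ∀ z ∈ Metric.ball (0 : ℂ) 1, Θs 0 z = Θ z
  schur : ∀ n, IsSchur (Θs n)
  mobius : ∀ n, IsMobiusParameter (Θs n) (Γ.op n) fun z =>
    z • ((Γ.identF n).symm.toContinuousLinearEquiv.toContinuousLinearMap ∘L Θs (n + 1) z ∘L
      (Γ.identE n).toContinuousLinearEquiv.toContinuousLinearMap)

end ChoiceSequence

end Choice

end BlockCMV

end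

/-!
Write `J n` for the elementary rotation of `Γ n`. It is unitary by the intertwining relation
`T D_T = D_{T*} T` (`isUnitaryOp_rotation`), so the CMV matrices, being products of direct sums of
rotations, are unitary and the systems are conservative. Moreover `Ũ₀ (I ⊕ V₀) = (I ⊕ V₀) U₀`
(`zetat_op_opV`), that is, the two systems are unitarily similar, and it is enough to treat `U₀`.

*Transfer function.* The step of the Schur algorithm says that closing `J n` with `z Θ_{n+1}(z)` gives
`Θ_n(z)`: every `x` has an `x'` with `J n (x, z Θ_{n+1}(z) x') = (Θ_n(z) x, x')`
(`IsSchurAlgorithm.exists_rot_eq`). Iterating from an input `u` gives `x 0 = u, x 1, x 2, …` and the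
outputs `y n = Θ_{k+n}(z) (x n)`. This trajectory is bounded because the rotations are isometric
(`le_of_energy_balance`). A signal passes through `V₀` and then through `L₀` in one time step, so the
summands of the state space pick up increasing powers of `z`; these make the trajectory square
summable, and it becomes a state `h` with `U₀ (u, z h) = (Θ_k(z) u, h)`
(`IsSchurAlgorithm.exists_zeta_op_eq`). This determines the transfer function
(`LinearSystem.transfer_apply_of_op_eq`).

*Simplicity.* The orthogonal complement of the controllable and observable subspaces is a subspace
which the conservative system maps onto itself with zero input and zero output
(`LinearSystem.isSimple_of_isDecoupled_eq_bot`). In such a subspace `J k` has zero first input and zero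
first output, and as `D_{Γ k*}` is injective on `𝔇_{Γ k*}`, its second input and output vanish as well.
The neighbouring rotation then has zero first input and output, and so on along the chain: all
components vanish (`ChoiceSequence.zeta_isDecoupled_eq_bot`).
-/

noncomputable section

namespace BlockCMV

/-! ### Unitary operators -/

section Unitary

variable {X Y Z : Type*} [NormedAddCommGroup X] [InnerProductSpace ℂ X]
  [NormedAddCommGroup Y] [InnerProductSpace ℂ Y] [NormedAddCommGroup Z] [InnerProductSpace ℂ Z]

/-- A bounded operator between two possibly different Hilbert spaces is unitary, expressed without
the adjoint: it preserves the norm and is surjective. -/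
def IsUnitaryOp (T : X →L[ℂ] Y) : Prop := (∀ x, ‖T x‖ = ‖x‖) ∧ Function.Surjective T

namespace IsUnitaryOp

theorem comp {S : Y →L[ℂ] Z} {T : X →L[ℂ] Y} (hS : IsUnitaryOp S) (hT : IsUnitaryOp T) :
    IsUnitaryOp (S ∘L T) :=
  ⟨fun x => (hS.1 _).trans (hT.1 x), hS.2.comp hT.2⟩

theorem injective {T : X →L[ℂ] Y} (hT : IsUnitaryOp T) : Function.Injective T := by
  rw [injective_iff_map_eq_zero]
  intro x hx
  rw [← norm_eq_zero, ← hT.1 x, hx, norm_zero]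

theorem id : IsUnitaryOp (ContinuousLinearMap.id ℂ X) := ⟨fun _ => rfl, fun x => ⟨x, rfl⟩⟩

theorem of_equiv (e : X ≃ₗᵢ[ℂ] Y) :
    IsUnitaryOp e.toContinuousLinearEquiv.toContinuousLinearMap :=
  ⟨e.norm_map, e.surjective⟩

theorem diagOp {W : Type*} [NormedAddCommGroup W] [InnerProductSpace ℂ W]
    {S : X →L[ℂ] Y} {T : Z →L[ℂ] W} (hS : IsUnitaryOp S) (hT : IsUnitaryOp T) :
    IsUnitaryOp (diagOp S T) := by
  refine ⟨fun x => ?_, fun y => ?_⟩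
  · rw [← sq_eq_sq₀ (norm_nonneg _) (norm_nonneg _), WithLp.prod_norm_sq_eq_of_L2,
      WithLp.prod_norm_sq_eq_of_L2, blockOp_apply]
    simp [hS.1, hT.1]
  · obtain ⟨a, ha⟩ := hS.2 y.fst
    obtain ⟨b, hb⟩ := hT.2 y.snd
    refine ⟨WithLp.toLp 2 (a, b), ?_⟩
    rw [blockOp_apply]
    simp [ha, hb]
    rfl

theorem mapCLM {A B : ℕ → Type*} [∀ n, NormedAddCommGroup (A n)] [∀ n, InnerProductSpace ℂ (A n)]
    [∀ n, NormedAddCommGroup (B n)] [∀ n, InnerProductSpace ℂ (B n)]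
    {T : ∀ n, A n →L[ℂ] B n} {K : ℝ} (hK : 0 ≤ K) (hTK : ∀ n, ‖T n‖ ≤ K)
    (hT : ∀ n, IsUnitaryOp (T n)) : IsUnitaryOp (lp.mapCLM 2 T hK hTK) := by
  refine ⟨fun x => ?_, fun y => ?_⟩
  · rw [← sq_eq_sq₀ (norm_nonneg _) (norm_nonneg _), norm_sq_lp_two, norm_sq_lp_two]
    exact tsum_congr fun n => congrArg (· ^ 2) ((hT n).1 (x n))
  · choose x hx using fun n => (hT n).2 (y n)
    have hmem : Memℓp x 2 := by
      rw [memlp_two_iff]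
      refine (memlp_two_iff.1 (lp.memℓp y)).congr fun n => ?_
      rw [← hx n, (hT n).1]
    exact ⟨⟨x, hmem⟩, lp.ext (funext hx)⟩

theorem adj_apply [CompleteSpace X] [CompleteSpace Y] {T : X →L[ℂ] Y} (hT : IsUnitaryOp T) (x : X) :
    adj T (T x) = x :=
  congrArg (fun S : X →L[ℂ] X => S x) ((ContinuousLinearMap.norm_map_iff_adjoint_comp_self T).1 hT.1)

theorem apply_adj [CompleteSpace X] [CompleteSpace Y] {T : X →L[ℂ] Y} (hT : IsUnitaryOp T) (y : Y) :
    T (adj T y) = y := by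
  obtain ⟨x, rfl⟩ := hT.2 y
  rw [hT.adj_apply]

end IsUnitaryOp

end Unitary

/-! ### Elementary rotations -/

theorem diagOp_nonneg {E F : Type*} [NormedAddCommGroup E] [InnerProductSpace ℂ E]
    [NormedAddCommGroup F] [InnerProductSpace ℂ F] {a : E →L[ℂ] E} {d : F →L[ℂ] F}
    (ha : 0 ≤ a) (hd : 0 ≤ d) : 0 ≤ diagOp a d := by
  rw [ContinuousLinearMap.nonneg_iff_isPositive, ContinuousLinearMap.isPositive_def] at *
  refine ⟨fun x y => ?_, fun x => ?_⟩
  · have h1 := ha.1 x.fst y.fst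
    have h2 := hd.1 x.snd y.snd
    simp only [ContinuousLinearMap.coe_coe] at h1 h2
    simp [blockOp_apply, WithLp.prod_inner_apply, h1, h2]
  · have h1 := ha.2 x.fst
    have h2 := hd.2 x.snd
    rw [ContinuousLinearMap.reApplyInnerSelf_apply] at h1 h2 ⊢
    simpa [blockOp_apply, WithLp.prod_inner_apply] using add_nonneg h1 h2

/-- An operator that commutes with the square of a positive operator commutes with the positive
operator itself. -/
theorem apply_comm_of_sq_apply_comm {K : Type*} [NormedAddCommGroup K] [InnerProductSpace ℂ K]
    [CompleteSpace K] {Q S : K →L[ℂ] K} (hQ : 0 ≤ Q) (h : ∀ v, Q (Q (S v)) = S (Q (Q v))) (v : K) :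
    Q (S v) = S (Q v) := by
  have h1 : Commute (Q * Q) S := ContinuousLinearMap.ext h
  have h2 : Commute (CFC.sqrt (Q * Q)) S := h1.cfcₙ_nnreal _
  rw [CFC.sqrt_mul_self Q hQ] at h2
  exact congrArg (fun R : K →L[ℂ] K => R v) h2.eq

section Rotation

variable {E F : Type*} [NormedAddCommGroup E] [InnerProductSpace ℂ E] [CompleteSpace E]
  [NormedAddCommGroup F] [InnerProductSpace ℂ F] [CompleteSpace F]

theorem defectOp_defectOp {T : E →L[ℂ] F} (hT : ‖T‖ ≤ 1) (x : E) :
    defectOp T (defectOp T x) = x - adj T (T x) :=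
  congrArg (fun S : E →L[ℂ] E => S x) (defectOp_mul_self hT)

theorem defectOp_adj_defectOp_adj {T : E →L[ℂ] F} (hT : ‖T‖ ≤ 1) (y : F) :
    defectOp (adj T) (defectOp (adj T) y) = y - T (adj T y) := by
  simpa [adj] using defectOp_defectOp (norm_adj_le hT) y

/-- The intertwining relation `T D_T = D_{T*} T`. On `E ⊕ F` the operator `[0 0; T 0]` commutes with
`(I - T* T) ⊕ (I - T T*)`, hence with its square root, which is `D_T ⊕ D_{T*}`. -/
theorem apply_defectOp {T : E →L[ℂ] F} (hT : ‖T‖ ≤ 1) (x : E) :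
    T (defectOp T x) = defectOp (adj T) (T x) := by
  have h := apply_comm_of_sq_apply_comm (Q := diagOp (defectOp T) (defectOp (adj T)))
    (S := blockOp 0 0 T 0) (diagOp_nonneg (CFC.sqrt_nonneg _) (CFC.sqrt_nonneg _))
    (fun v => ?_) (WithLp.toLp 2 (x, 0))
  · have h' := congrArg WithLp.snd h
    simp only [blockOp_apply] at h'
    simpa using h'.symm
  · simp only [blockOp_apply]
    simp [defectOp_defectOp hT, defectOp_adj_defectOp_adj hT]

theorem adj_defectOp {T : E →L[ℂ] F} (hT : ‖T‖ ≤ 1) (y : F) :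
    adj T (defectOp (adj T) y) = defectOp T (adj T y) := by
  simpa [adj] using apply_defectOp (norm_adj_le hT) y

theorem rotation_apply (T : E →L[ℂ] F) (x : E) (y : defectSpace (adj T)) :
    rotation T (WithLp.toLp 2 (x, y)) =
      WithLp.toLp 2 (T x + defectOp (adj T) y, defectTo T x - adjRestrict T y) := by
  rw [sub_eq_add_neg]
  rfl

theorem eq_zero_of_defectOp_eq_zero (T : E →L[ℂ] F) {x : E} (hx : x ∈ defectSpace T)
    (h : defectOp T x = 0) : x = 0 := by
  have hle : defectSpace T ≤ (ℂ ∙ x)ᗮ := by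
    refine Submodule.topologicalClosure_minimal _ ?_ (Submodule.isClosed_orthogonal _)
    rintro _ ⟨z, rfl⟩
    rw [Submodule.mem_orthogonal_singleton_iff_inner_right]
    change inner ℂ x (defectOp T z) = 0
    rw [← defectOp_inner, h, inner_zero_left]
  exact inner_self_eq_zero.1 (Submodule.mem_orthogonal_singleton_iff_inner_right.1 (hle hx))

/-- The elementary rotation of a contraction is unitary; its inverse is
`[T* D_T; D_{T*} -T]`. -/
theorem isUnitaryOp_rotation {T : E →L[ℂ] F} (hT : ‖T‖ ≤ 1) : IsUnitaryOp (rotation T) := by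
  refine ⟨fun v => ?_, fun v => ?_⟩
  · obtain ⟨x, y⟩ := v
    have hx := norm_defectOp_apply_sq hT x
    have hy := norm_defectOp_apply_sq (norm_adj_le hT) (y : F)
    have hcross : inner ℂ (T x) (defectOp (adj T) y) = inner ℂ (defectOp T x) (adj T y) := by
      rw [← ContinuousLinearMap.adjoint_inner_right, adj_defectOp hT, defectOp_inner]
    have h1 := norm_add_sq (𝕜 := ℂ) (T x) (defectOp (adj T) y)
    have h2 := norm_sub_sq (𝕜 := ℂ) (defectOp T x) (adj T y)
    rw [← sq_eq_sq₀ (norm_nonneg _) (norm_nonneg _), rotation_apply,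
      WithLp.prod_norm_sq_eq_of_L2, WithLp.prod_norm_sq_eq_of_L2]
    have h3 : ‖defectTo T x - adjRestrict T y‖ = ‖defectOp T x - adj T y‖ := by
      rw [← coe_adjRestrict hT]
      rfl
    have h4 : ‖y‖ = ‖(y : F)‖ := rfl
    simp only [WithLp.toLp_fst, WithLp.toLp_snd]
    rw [h3, h1, h2, hcross, h4]
    linarith
  · obtain ⟨y, d⟩ := v
    have hmem : defectOp (adj T) y - T d ∈ defectSpace (adj T) := by
      refine sub_mem (defectOp_mem _ _) ?_
      have := adj_mem_defectSpace (norm_adj_le hT) (y := (d : E)) (by simp [adj])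
      simpa [adj] using this
    refine ⟨WithLp.toLp 2 (adj T y + defectOp T d, ⟨_, hmem⟩), ?_⟩
    rw [rotation_apply]
    have e1 : T (adj T y + defectOp T d) + defectOp (adj T) (defectOp (adj T) y - T d) = y := by
      rw [map_add, map_sub, defectOp_adj_defectOp_adj hT, apply_defectOp hT]
      abel
    have e2 : defectTo T (adj T y + defectOp T d) - adjRestrict T ⟨_, hmem⟩ = d := by
      ext
      rw [Submodule.coe_sub, coe_adjRestrict hT]
      change defectOp T (adj T y + defectOp T d) - adj T (defectOp (adj T) y - T d) = d
      rw [map_add, map_sub, defectOp_defectOp hT, adj_defectOp hT]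
      abel
    rw [e1, e2]

end Rotation

/-! ### Conservative systems -/

namespace LinearSystem

variable {U Y H : Type*} [NormedAddCommGroup U] [InnerProductSpace ℂ U]
  [NormedAddCommGroup Y] [InnerProductSpace ℂ Y] [NormedAddCommGroup H] [InnerProductSpace ℂ H]
  {τ : LinearSystem U Y H}

theorem op_apply (τ : LinearSystem U Y H) (u : U) (h : H) :
    τ.op (WithLp.toLp 2 (u, h)) =
      WithLp.toLp 2 (τ.feedthrough u + τ.observation h, τ.control u + τ.state h) := by
  have hv : WithLp.toLp 2 (u, h) = inlL U H u + inrL U H h := by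
    change WithLp.toLp 2 (u, h) = WithLp.toLp 2 (u, 0) + WithLp.toLp 2 (0, h)
    rw [← WithLp.toLp_add]
    simp
  rw [hv, map_add]
  rfl

theorem norm_state_apply_le (hτ : IsUnitaryOp τ.op) (h : H) : ‖τ.state h‖ ≤ ‖h‖ := by
  have h1 := hτ.1 (WithLp.toLp 2 ((0 : U), h))
  rw [← sq_eq_sq₀ (norm_nonneg _) (norm_nonneg _), op_apply, WithLp.prod_norm_sq_eq_of_L2,
    WithLp.prod_norm_sq_eq_of_L2] at h1
  simp only [map_zero, zero_add, WithLp.toLp_fst, WithLp.toLp_snd, norm_zero] at h1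
  refine le_of_sq_le_sq ?_ (norm_nonneg _)
  nlinarith [sq_nonneg ‖τ.observation h‖]

/-- A subspace of the state space is decoupled if the system maps it onto itself with zero input and
zero output. -/
def IsDecoupled (τ : LinearSystem U Y H) (S : Submodule ℂ H) : Prop :=
  (∀ h ∈ S, ∃ h' ∈ S, τ.op (WithLp.toLp 2 (0, h)) = WithLp.toLp 2 (0, h')) ∧
  ∀ h ∈ S, ∃ h' ∈ S, τ.op (WithLp.toLp 2 (0, h')) = WithLp.toLp 2 (0, h)

/-- The transfer function through closing the loop: if the system maps `(u, z h)` to `(y, h)`, then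
`h = (I - z A)⁻¹ B u` and `y` is the value of the transfer function. -/
theorem transfer_apply_of_op_eq [CompleteSpace H] (hτ : IsUnitaryOp τ.op) {z : ℂ}
    (hz : ‖z‖ < 1) {u : U} {y : Y} {h : H}
    (hu : τ.op (WithLp.toLp 2 (u, z • h)) = WithLp.toLp 2 (y, h)) :
    τ.transfer z u = y := by
  rw [op_apply] at hu
  have h1 : τ.feedthrough u + τ.observation (z • h) = y := congrArg WithLp.fst hu
  have h2 : τ.control u + τ.state (z • h) = h := congrArg WithLp.snd hu
  have hA : ‖τ.state‖ ≤ 1 := ContinuousLinearMap.opNorm_le_bound _ zero_le_one fun x => by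
    simpa using norm_state_apply_le hτ x
  have hunit : IsUnit (1 - z • τ.state) := by
    refine isUnit_one_sub_of_norm_lt_one ?_
    rw [norm_smul]
    exact (mul_le_of_le_one_right (norm_nonneg _) hA).trans_lt hz
  have h3 : τ.control u = (1 - z • τ.state) h := by
    rw [map_smul] at h2
    change _ = h - z • τ.state h
    exact eq_sub_of_add_eq h2
  have h4 : Ring.inverse (1 - z • τ.state) (τ.control u) = h := by
    rw [h3]
    exact congrArg (fun S : H →L[ℂ] H => S h) (Ring.inverse_mul_cancel _ hunit)
  change τ.feedthrough u + z • τ.observation (Ring.inverse (1 - z • τ.state) (τ.control u)) = y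
  rw [h4, ← map_smul, h1]

variable [CompleteSpace U] [CompleteSpace Y] [CompleteSpace H]

theorem isConservative_of_isUnitaryOp (hτ : IsUnitaryOp τ.op) : τ.IsConservative :=
  ⟨ContinuousLinearMap.ext hτ.adj_apply, ContinuousLinearMap.ext hτ.apply_adj⟩

theorem adj_op_zero_apply (τ : LinearSystem U Y H) (h : H) :
    adj τ.op (WithLp.toLp 2 (0, h)) = WithLp.toLp 2 (adj τ.control h, adj τ.state h) := by
  refine ext_inner_left ℂ fun v => ?_
  obtain ⟨u, k⟩ := v
  rw [ContinuousLinearMap.adjoint_inner_right, op_apply]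
  simp [WithLp.prod_inner_apply, inner_add_left, ContinuousLinearMap.adjoint_inner_right]

/-- The orthogonal complement of the controllable and observable subspaces is decoupled, so a
conservative system without nonzero decoupled subspaces is simple. -/
theorem isSimple_of_isDecoupled_eq_bot (hτ : IsUnitaryOp τ.op)
    (h : ∀ S, τ.IsDecoupled S → S = ⊥) : τ.IsSimple := by
  set S : Submodule ℂ H := (⨅ n : ℕ, LinearMap.ker (τ.observation ∘L τ.state ^ n).toLinearMap) ⊓
    ⨅ n : ℕ, LinearMap.ker (adj τ.control ∘L adj τ.state ^ n).toLinearMap with hS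
  have mem : ∀ x, x ∈ S ↔ (∀ n : ℕ, τ.observation ((τ.state ^ n) x) = 0) ∧
      ∀ n : ℕ, adj τ.control ((adj τ.state ^ n) x) = 0 := by
    intro x
    simp only [hS, Submodule.mem_inf, Submodule.mem_iInf, LinearMap.mem_ker]
    rfl
  have fwd : ∀ x ∈ S, τ.op (WithLp.toLp 2 (0, x)) = WithLp.toLp 2 (0, τ.state x) := by
    intro x hx
    have h0 : τ.observation x = 0 := by simpa using ((mem x).1 hx).1 0
    rw [op_apply, h0]
    simp
  have bwd : ∀ x ∈ S, τ.op (WithLp.toLp 2 (0, adj τ.state x)) = WithLp.toLp 2 (0, x) := by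
    intro x hx
    have h0 : adj τ.control x = 0 := by simpa using ((mem x).1 hx).2 0
    have h1 := adj_op_zero_apply τ x
    rw [h0] at h1
    rw [← h1, hτ.apply_adj]
  have fwd' : ∀ x ∈ S, adj τ.control (τ.state x) = 0 ∧ adj τ.state (τ.state x) = x := by
    intro x hx
    have h1 := adj_op_zero_apply τ (τ.state x)
    rw [← fwd x hx, hτ.adj_apply] at h1
    exact ⟨(congrArg WithLp.fst h1).symm, (congrArg WithLp.snd h1).symm⟩
  have bwd' : ∀ x ∈ S, τ.observation (adj τ.state x) = 0 ∧ τ.state (adj τ.state x) = x := by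
    intro x hx
    have h1 := bwd x hx
    rw [op_apply] at h1
    exact ⟨by simpa using congrArg WithLp.fst h1, by simpa using congrArg WithLp.snd h1⟩
  have hdec : τ.IsDecoupled S := by
    refine ⟨fun x hx => ⟨τ.state x, (mem _).2 ⟨fun n => ?_, fun n => ?_⟩, fwd x hx⟩,
      fun x hx => ⟨adj τ.state x, (mem _).2 ⟨fun n => ?_, fun n => ?_⟩, bwd x hx⟩⟩
    · have := ((mem x).1 hx).1 (n + 1)
      rwa [pow_succ] at this
    · cases n with
      | zero => simpa using (fwd' x hx).1
      | succ n =>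
        rw [pow_succ]
        change adj τ.control ((adj τ.state ^ n) (adj τ.state (τ.state x))) = 0
        rw [(fwd' x hx).2]
        exact ((mem x).1 hx).2 n
    · cases n with
      | zero => simpa using (bwd' x hx).1
      | succ n =>
        rw [pow_succ]
        change τ.observation ((τ.state ^ n) (τ.state (adj τ.state x))) = 0
        rw [(bwd' x hx).2]
        exact ((mem x).1 hx).1 n
    · have := ((mem x).1 hx).2 (n + 1)
      rwa [pow_succ] at this
  have hbot := h S hdec
  rw [IsSimple, Submodule.topologicalClosure_eq_top_iff, Submodule.eq_bot_iff]
  intro x hx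
  have hx' : ∀ y ∈ τ.controllable ⊔ τ.observable, inner ℂ y x = 0 :=
    (Submodule.mem_orthogonal _ _).1 hx
  rw [← Submodule.mem_bot ℂ, ← hbot, mem]
  have hpow : ∀ n : ℕ, adj (τ.state ^ n) = adj τ.state ^ n := fun n => by
    change star (τ.state ^ n) = star τ.state ^ n
    exact star_pow _ _
  refine ⟨fun n => ext_inner_left ℂ fun y => ?_, fun n => ext_inner_left ℂ fun u => ?_⟩
  · have := hx' ((adj τ.state ^ n) (adj τ.observation y)) (Submodule.mem_sup_right
      (Submodule.le_topologicalClosure _ (Submodule.mem_iSup_of_mem n ⟨y, rfl⟩)))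
    rwa [← hpow, ContinuousLinearMap.adjoint_inner_left, ContinuousLinearMap.adjoint_inner_left,
      ← inner_zero_right y] at this
  · have := hx' ((τ.state ^ n) (τ.control u)) (Submodule.mem_sup_left
      (Submodule.le_topologicalClosure _ (Submodule.mem_iSup_of_mem n ⟨u, rfl⟩)))
    rw [ContinuousLinearMap.adjoint_inner_right, ← hpow, ContinuousLinearMap.adjoint_inner_right,
      this, inner_zero_right]

end LinearSystem

namespace ChoiceSequence

universe u v

variable {M : Type u} {N : Type v}
  [NormedAddCommGroup M] [InnerProductSpace ℂ M] [CompleteSpace M]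
  [NormedAddCommGroup N] [InnerProductSpace ℂ N] [CompleteSpace N]
  (Γ : ChoiceSequence M N)

/-! ### The blocks of the CMV matrices are unitary -/

theorem isUnitaryOp_rot (n : ℕ) : IsUnitaryOp (Γ.rot n) :=
  (IsUnitaryOp.id.diagOp (.of_equiv _)).comp
    ((isUnitaryOp_rotation (Γ.norm_op_le n)).comp (IsUnitaryOp.id.diagOp (.of_equiv _)))

theorem rot_apply (n : ℕ) (x : Γ.E n) (y : Γ.F (n + 1)) :
    Γ.rot n (WithLp.toLp 2 (x, y)) =
      WithLp.toLp 2 (Γ.op n x + defectOp (adj (Γ.op n)) ((Γ.identF n).symm y),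
        Γ.identE n (defectTo (Γ.op n) x - adjRestrict (Γ.op n) ((Γ.identF n).symm y))) := by
  have h := rotation_apply (Γ.op n) x ((Γ.identF n).symm y)
  simp only [rot, ContinuousLinearMap.comp_apply, blockOp_apply]
  simp [h]

/-- If a rotation has zero first input and zero first output, then its second input vanishes, since
`D_{Γ n*}` is injective on `𝔇_{Γ n*}`. -/
theorem eq_zero_of_rot_fst_eq_zero {n : ℕ} {y : Γ.F (n + 1)} {e : Γ.E (n + 1)}
    (h : Γ.rot n (WithLp.toLp 2 (0, y)) = WithLp.toLp 2 (0, e)) : y = 0 ∧ e = 0 := by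
  have h' := h
  rw [rot_apply] at h'
  have h1 : Γ.op n 0 + defectOp (adj (Γ.op n)) ((Γ.identF n).symm y) = 0 := congrArg WithLp.fst h'
  rw [map_zero, zero_add] at h1
  have h2 : (Γ.identF n).symm y = 0 :=
    Subtype.ext (eq_zero_of_defectOp_eq_zero _ ((Γ.identF n).symm y).2 h1)
  have hy : y = 0 := by simpa using h2
  refine ⟨hy, ?_⟩
  subst hy
  have h3 : Γ.rot n 0 = WithLp.toLp 2 (0, e) := h
  rw [map_zero] at h3
  exact (congrArg WithLp.snd h3).symm

theorem isUnitaryOp_opV (k : ℕ) : IsUnitaryOp (Γ.opV k) :=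
  .mapCLM _ _ fun _ => Γ.isUnitaryOp_rot _

theorem isUnitaryOp_opL (k : ℕ) : IsUnitaryOp (Γ.opL k) :=
  (IsUnitaryOp.of_equiv _).comp ((IsUnitaryOp.mapCLM _ _ fun _ => Γ.isUnitaryOp_rot _).comp
    (.of_equiv _))

theorem isUnitaryOp_zeta (k : ℕ) : IsUnitaryOp (Γ.zeta k).op :=
  (Γ.isUnitaryOp_opL k).comp (IsUnitaryOp.id.diagOp (Γ.isUnitaryOp_opV k))

theorem isUnitaryOp_zetat (k : ℕ) : IsUnitaryOp (Γ.zetat k).op :=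
  (IsUnitaryOp.id.diagOp (Γ.isUnitaryOp_opV k)).comp (Γ.isUnitaryOp_opL k)

theorem isConservative_zeta (k : ℕ) : (Γ.zeta k).IsConservative :=
  LinearSystem.isConservative_of_isUnitaryOp (Γ.isUnitaryOp_zeta k)

theorem isConservative_zetat (k : ℕ) : (Γ.zetat k).IsConservative :=
  LinearSystem.isConservative_of_isUnitaryOp (Γ.isUnitaryOp_zetat k)

theorem zeta_op_apply (k : ℕ) (u : Γ.E k) (h : Γ.H k) :
    (Γ.zeta k).op (WithLp.toLp 2 (u, h)) = Γ.opL k (WithLp.toLp 2 (u, Γ.opV k h)) := by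
  change Γ.opL k (diagOp _ _ _) = _
  rw [blockOp_apply]
  simp

/-- The operator `I ⊕ V₀` intertwines the two CMV matrices, as `M̃₀ L₀ M₀ = M̃₀ (L₀ M₀)`. -/
theorem zetat_op_opV (k : ℕ) (u : Γ.E k) (h : Γ.H k) :
    (Γ.zetat k).op (WithLp.toLp 2 (u, Γ.opV k h)) =
      Γ.opMt k ((Γ.zeta k).op (WithLp.toLp 2 (u, h))) := by
  rw [zeta_op_apply]
  rfl

theorem opMt_apply (k : ℕ) (y : Γ.F k) (h : Γ.H k) :
    Γ.opMt k (WithLp.toLp 2 (y, h)) = WithLp.toLp 2 (y, Γ.opV k h) := by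
  rw [opMt, blockOp_apply]
  simp

/-- The block rows of `L₀`: equality of `L₀ (u, g)` and `(y, h)` is checked on each rotation. -/
theorem opL_eq_iff (k : ℕ) (u : Γ.E k) (g : Γ.Ht k) (y : Γ.F k) (h : Γ.H k) :
    Γ.opL k (WithLp.toLp 2 (u, g)) = WithLp.toLp 2 (y, h) ↔
      Γ.rot k (WithLp.toLp 2 (u, (g 0).fst)) = WithLp.toLp 2 (y, (h 0).fst) ∧
      ∀ n, Γ.rot (k + 2 * (n + 1)) (WithLp.toLp 2 ((g n).snd, (g (n + 1)).fst)) =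
        WithLp.toLp 2 ((h n).snd, (h (n + 1)).fst) := by
  have h0 : Γ.opL k (WithLp.toLp 2 (u, g)) = WithLp.toLp 2 (y, h) ↔
      Γ.evenRot k (regroup (P := fun n => Γ.E (k + 2 * n))
        (Q := fun n => Γ.F (k + 2 * n + 1)) (WithLp.toLp 2 (u, g))) =
      regroup (P := fun n => Γ.F (k + 2 * n))
        (Q := fun n => Γ.E (k + 2 * n + 1)) (WithLp.toLp 2 (y, h)) :=
    (regroup (P := fun n => Γ.F (k + 2 * n))
      (Q := fun n => Γ.E (k + 2 * n + 1))).toEquiv.symm_apply_eq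
  rw [h0]
  constructor
  · intro h1
    have h2 := fun n => congrFun (congrArg Subtype.val h1) n
    exact ⟨h2 0, fun n => h2 (n + 1)⟩
  · rintro ⟨h1, h2⟩
    refine lp.ext (funext fun n => ?_)
    cases n with
    | zero => exact h1
    | succ n => exact h2 n

/-! ### Simplicity -/

/-- The CMV matrix has no nonzero decoupled subspace: the components of its vectors, and those of their
images under `V₀`, vanish one after the other. -/
theorem zeta_isDecoupled_eq_bot (k : ℕ) (S : Submodule ℂ (Γ.H k))
    (hS : (Γ.zeta k).IsDecoupled S) : S = ⊥ := by
  have step : ∀ h h', (Γ.zeta k).op (WithLp.toLp 2 (0, h)) = WithLp.toLp 2 (0, h') →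
      Γ.rot k (WithLp.toLp 2 (0, (Γ.opV k h 0).fst)) = WithLp.toLp 2 (0, (h' 0).fst) ∧
      ∀ n, Γ.rot (k + 2 * (n + 1))
          (WithLp.toLp 2 ((Γ.opV k h n).snd, (Γ.opV k h (n + 1)).fst)) =
        WithLp.toLp 2 ((h' n).snd, (h' (n + 1)).fst) := fun h h' e => by
    rw [zeta_op_apply] at e
    exact (Γ.opL_eq_iff k _ _ _ _).1 e
  -- an odd rotation passes the vanishing of the first entries on to the second ones
  have odd : ∀ n, (∀ h ∈ S, (h n).fst = 0 ∧ (Γ.opV k h n).fst = 0) →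
      ∀ h ∈ S, (h n).snd = 0 ∧ (Γ.opV k h n).snd = 0 := fun n hn h hh => by
    obtain ⟨h1, h2⟩ := hn h hh
    refine Γ.eq_zero_of_rot_fst_eq_zero (n := k + 2 * n + 1) ?_
    rw [← h1, ← h2]
    rfl
  have fst_zero : ∀ n, ∀ h ∈ S, (h n).fst = 0 ∧ (Γ.opV k h n).fst = 0 := by
    intro n
    induction n with
    | zero =>
      intro h hh
      -- the image `a` of `h` gives the component of `V₀ h`, the preimage `b` that of `h`
      obtain ⟨a, -, ha⟩ := hS.1 h hh
      obtain ⟨b, -, hb⟩ := hS.2 h hh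
      exact ⟨(Γ.eq_zero_of_rot_fst_eq_zero (step _ _ hb).1).2,
        (Γ.eq_zero_of_rot_fst_eq_zero (step _ _ ha).1).1⟩
    | succ n ih =>
      have hsnd := odd n ih
      intro h hh
      obtain ⟨a, haS, ha⟩ := hS.1 h hh
      obtain ⟨b, hbS, hb⟩ := hS.2 h hh
      have ha' := (step _ _ ha).2 n
      have hb' := (step _ _ hb).2 n
      rw [(hsnd h hh).2, (hsnd a haS).1] at ha'
      rw [(hsnd b hbS).2, (hsnd h hh).1] at hb'
      exact ⟨(Γ.eq_zero_of_rot_fst_eq_zero hb').2, (Γ.eq_zero_of_rot_fst_eq_zero ha').1⟩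
  rw [Submodule.eq_bot_iff]
  intro h hh
  refine lp.ext (funext fun n => ?_)
  apply (WithLp.equiv 2 _).injective
  exact Prod.ext (fst_zero n h hh).1 (odd n (fst_zero n) h hh).1

theorem zetat_isDecoupled_eq_bot (k : ℕ) (S : Submodule ℂ (Γ.Ht k))
    (hS : (Γ.zetat k).IsDecoupled S) : S = ⊥ := by
  have hV := Γ.isUnitaryOp_opV k
  have hMt : IsUnitaryOp (Γ.opMt k) := IsUnitaryOp.id.diagOp hV
  have key : ∀ h h', (Γ.zetat k).op (WithLp.toLp 2 (0, Γ.opV k h)) =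
      WithLp.toLp 2 (0, Γ.opV k h') →
      (Γ.zeta k).op (WithLp.toLp 2 (0, h)) = WithLp.toLp 2 (0, h') := fun h h' e => by
    rw [zetat_op_opV, ← opMt_apply] at e
    exact hMt.injective e
  have hbot := Γ.zeta_isDecoupled_eq_bot k (S.comap (Γ.opV k).toLinearMap) (by
    refine ⟨fun h hh => ?_, fun h hh => ?_⟩
    · obtain ⟨g, hg, e⟩ := hS.1 _ hh
      obtain ⟨h', rfl⟩ := hV.2 g
      exact ⟨h', hg, key _ _ e⟩
    · obtain ⟨g, hg, e⟩ := hS.2 _ hh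
      obtain ⟨h', rfl⟩ := hV.2 g
      exact ⟨h', hg, key _ _ e⟩)
  rw [Submodule.eq_bot_iff]
  intro g hg
  obtain ⟨h, rfl⟩ := hV.2 g
  have hh : h ∈ S.comap (Γ.opV k).toLinearMap := hg
  rw [hbot, Submodule.mem_bot] at hh
  rw [hh, map_zero]

theorem isSimple_zeta (k : ℕ) : (Γ.zeta k).IsSimple :=
  LinearSystem.isSimple_of_isDecoupled_eq_bot (Γ.isUnitaryOp_zeta k) (Γ.zeta_isDecoupled_eq_bot k)

theorem isSimple_zetat (k : ℕ) : (Γ.zetat k).IsSimple :=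
  LinearSystem.isSimple_of_isDecoupled_eq_bot (Γ.isUnitaryOp_zetat k) (Γ.zetat_isDecoupled_eq_bot k)

/-! ### The transfer functions -/

variable {Γ} {Θ : ℂ → M →L[ℂ] N} {Θs : ∀ n, ℂ → Γ.E n →L[ℂ] Γ.F n}

/-- One step of the Schur algorithm as a rotation: closing `J_{Γ n}` with `z Θ_{n+1}(z)` gives
`Θ_n(z)`. The vector `x'` is `(I + z Γ n* Θ_{n+1}(z))⁻¹ D_{Γ n} x`. -/
theorem IsSchurAlgorithm.exists_rot_eq (hΓ : Γ.IsSchurAlgorithm Θ Θs) {z : ℂ}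
    (hz : z ∈ Metric.ball (0 : ℂ) 1) (n : ℕ) (x : Γ.E n) :
    ∃ x' : Γ.E (n + 1), Γ.rot n (WithLp.toLp 2 (x, z • Θs (n + 1) z x')) =
      WithLp.toLp 2 (Θs n z x, x') := by
  obtain ⟨hunit, hval⟩ := (hΓ.mobius n).2.2 z hz
  set Z : defectSpace (Γ.op n) →L[ℂ] defectSpace (adj (Γ.op n)) :=
    z • ((Γ.identF n).symm.toContinuousLinearEquiv.toContinuousLinearMap ∘L Θs (n + 1) z ∘L
      (Γ.identE n).toContinuousLinearEquiv.toContinuousLinearMap) with hZ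
  set w := Ring.inverse (1 + adjRestrict (Γ.op n) ∘L Z) (defectTo (Γ.op n) x) with hw
  have h1 : w + adjRestrict (Γ.op n) (Z w) = defectTo (Γ.op n) x :=
    congrArg (fun S : defectSpace (Γ.op n) →L[ℂ] defectSpace (Γ.op n) => S (defectTo (Γ.op n) x))
      (Ring.mul_inverse_cancel _ hunit)
  have h2 : (Γ.identF n).symm (z • Θs (n + 1) z (Γ.identE n w)) = Z w := map_smul _ _ _
  have h3 : Θs n z x = Γ.op n x + defectOp (adj (Γ.op n)) (Z w) := by
    rw [hval]
    rfl
  refine ⟨Γ.identE n w, ?_⟩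
  rw [rot_apply, h2, ← h1, add_sub_cancel_right, h3]

/-- The trajectory of the Schur algorithm that starts at `u`, obtained by iterating
`IsSchurAlgorithm.exists_rot_eq`. -/
theorem IsSchurAlgorithm.exists_trajectory (hΓ : Γ.IsSchurAlgorithm Θ Θs) {z : ℂ}
    (hz : z ∈ Metric.ball (0 : ℂ) 1) (k : ℕ) (u : Γ.E k) :
    ∃ x : ∀ n, Γ.E (k + n), x 0 = u ∧ ∀ n,
      Γ.rot (k + n) (WithLp.toLp 2 (x n, z • Θs (k + n + 1) z (x (n + 1)))) =
        WithLp.toLp 2 (Θs (k + n) z (x n), x (n + 1)) := by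
  choose φ hφ using fun n => hΓ.exists_rot_eq hz n
  exact ⟨fun n => Nat.rec (motive := fun n => Γ.E (k + n)) u (fun n x => φ (k + n) x) n, rfl,
    fun n => hφ (k + n) _⟩

/-- Used with `a n = ‖x n‖²`, `b n = ‖Θ_{k+n}(z) (x n)‖²` and `r = |z|²` for a trajectory `x`; the
hypothesis `h` then says that the rotations are isometric. By it `a n - b n` is decreasing. -/
theorem le_of_energy_balance {a b : ℕ → ℝ} {r : ℝ} (hr : 0 ≤ r) (hr1 : r < 1)
    (hb : ∀ n, 0 ≤ b n) (hba : ∀ n, b n ≤ a n)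
    (h : ∀ n, a n + r * b (n + 1) = b n + a (n + 1)) (n : ℕ) : a n ≤ a 0 / (1 - r) := by
  have hanti : ∀ n, a n - b n ≤ a 0 := by
    intro n
    induction n with
    | zero => linarith [hb 0]
    | succ n ih => nlinarith [h n, hb (n + 1)]
  rw [le_div_iff₀ (by linarith)]
  cases n with
  | zero => nlinarith [hb 0, hba 0]
  | succ n => nlinarith [h n, hanti n, mul_nonneg hr (sub_nonneg.2 (hba (n + 1)))]

theorem IsSchurAlgorithm.trajectory_bounded (hΓ : Γ.IsSchurAlgorithm Θ Θs) {z : ℂ}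
    (hz : z ∈ Metric.ball (0 : ℂ) 1) {k : ℕ} {x : ∀ n, Γ.E (k + n)}
    (hx : ∀ n, Γ.rot (k + n) (WithLp.toLp 2 (x n, z • Θs (k + n + 1) z (x (n + 1)))) =
        WithLp.toLp 2 (Θs (k + n) z (x n), x (n + 1))) :
    ∃ C, ∀ n, ‖x n‖ ^ 2 ≤ C ∧ ‖Θs (k + n) z (x n)‖ ^ 2 ≤ C := by
  have hz1 : ‖z‖ < 1 := mem_ball_zero_iff.1 hz
  have hle : ∀ n, ‖Θs (k + n) z (x n)‖ ^ 2 ≤ ‖x n‖ ^ 2 := fun n => by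
    have := (Θs (k + n) z).le_of_opNorm_le ((hΓ.schur (k + n)).2 z hz) (x n)
    rw [one_mul] at this
    gcongr
  have hbound := le_of_energy_balance (a := fun n => ‖x n‖ ^ 2)
    (b := fun n => ‖Θs (k + n) z (x n)‖ ^ 2) (r := ‖z‖ ^ 2) (by positivity)
    (by nlinarith [norm_nonneg z]) (fun n => by positivity) hle (fun n => by
      have h1 := (Γ.isUnitaryOp_rot (k + n)).1
        (WithLp.toLp 2 (x n, z • Θs (k + n + 1) z (x (n + 1))))
      rw [hx n, ← sq_eq_sq₀ (norm_nonneg _) (norm_nonneg _), WithLp.prod_norm_sq_eq_of_L2,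
        WithLp.prod_norm_sq_eq_of_L2] at h1
      simp only [WithLp.toLp_fst, WithLp.toLp_snd, norm_smul, mul_pow] at h1
      exact h1.symm)
  exact ⟨_, fun n => ⟨hbound n, (hle n).trans (hbound n)⟩⟩

/-- The state of the CMV system that closes the loop at `z`. Along a trajectory `x n` with
`y n = Θ_{k+n}(z) x n` it is `(zⁿ x (2n+1), zⁿ⁺¹ y (2n+2))_n`. -/
theorem IsSchurAlgorithm.exists_zeta_op_eq (hΓ : Γ.IsSchurAlgorithm Θ Θs) {z : ℂ}
    (hz : z ∈ Metric.ball (0 : ℂ) 1) (k : ℕ) (u : Γ.E k) :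
    ∃ h, (Γ.zeta k).op (WithLp.toLp 2 (u, z • h)) = WithLp.toLp 2 (Θs k z u, h) := by
  obtain ⟨x, rfl, hx⟩ := hΓ.exists_trajectory hz k u
  obtain ⟨C, hC⟩ := hΓ.trajectory_bounded hz hx
  have hz1 : ‖z‖ < 1 := mem_ball_zero_iff.1 hz
  have hr : ‖z‖ ^ 2 < 1 := by nlinarith [norm_nonneg z]
  set f : ∀ n, WithLp 2 (Γ.E (k + 2 * n + 1) × Γ.F (k + 2 * (n + 1))) := fun n =>
    WithLp.toLp 2 (z ^ n • x (2 * n + 1), z ^ (n + 1) • Θs (k + 2 * (n + 1)) z (x (2 * (n + 1))))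
    with hf
  have hmem : Memℓp f 2 := by
    rw [memlp_two_iff]
    refine Summable.of_nonneg_of_le (fun n => by positivity) (fun n => ?_)
      ((summable_geometric_of_lt_one (by positivity) hr).mul_right (2 * C))
    have h1 := (hC (2 * n + 1)).1
    have h2 := (hC (2 * (n + 1))).2
    rw [WithLp.prod_norm_sq_eq_of_L2]
    change ‖z ^ n • x (2 * n + 1)‖ ^ 2 +
      ‖z ^ (n + 1) • Θs (k + 2 * (n + 1)) z (x (2 * (n + 1)))‖ ^ 2 ≤ _
    have e1 : (‖z‖ ^ n) ^ 2 = (‖z‖ ^ 2) ^ n := by ring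
    have e2 : (‖z‖ ^ (n + 1)) ^ 2 = ‖z‖ ^ 2 * (‖z‖ ^ 2) ^ n := by ring
    rw [norm_smul, norm_smul, norm_pow, norm_pow, mul_pow, mul_pow, e1, e2]
    have hp : 0 ≤ (‖z‖ ^ 2) ^ n := by positivity
    have h3 := mul_le_mul_of_nonneg_left h1 hp
    have h4 := mul_le_mul_of_nonneg_left h2 hp
    have h5 := mul_le_of_le_one_left (mul_nonneg hp
      (sq_nonneg ‖Θs (k + 2 * (n + 1)) z (x (2 * (n + 1)))‖)) hr.le
    linarith
  -- a trajectory stays one after multiplication by a scalar; the state consists of such multiples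
  have hscale : ∀ (c d : ℂ) (n : ℕ), d = c * z →
      Γ.rot (k + n) (WithLp.toLp 2 (c • x n, d • Θs (k + n + 1) z (x (n + 1)))) =
        WithLp.toLp 2 (c • Θs (k + n) z (x n), c • x (n + 1)) := by
    rintro c _ n rfl
    rw [mul_smul, ← Prod.smul_mk, WithLp.toLp_smul, map_smul, hx, ← WithLp.toLp_smul, Prod.smul_mk]
  have hV : ∀ n, Γ.opV k (z • ⟨f, hmem⟩) n = WithLp.toLp 2
      (z ^ (n + 1) • Θs (k + 2 * n + 1) z (x (2 * n + 1)), z ^ (n + 1) • x (2 * (n + 1))) := by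
    intro n
    change Γ.rot (k + 2 * n + 1) (WithLp.toLp 2 (z • z ^ n • x (2 * n + 1),
      z • z ^ (n + 1) • Θs (k + 2 * (n + 1)) z (x (2 * (n + 1))))) = _
    rw [smul_smul, smul_smul, ← pow_succ', ← pow_succ']
    exact hscale _ _ (2 * n + 1) (pow_succ _ _)
  refine ⟨⟨f, hmem⟩, ?_⟩
  rw [zeta_op_apply, opL_eq_iff]
  refine ⟨?_, fun n => ?_⟩
  · have h0 := hscale 1 (z ^ (0 + 1)) 0 (by simp)
    simp only [one_smul] at h0
    rw [hV]
    change _ = WithLp.toLp 2 (_, z ^ 0 • x (2 * 0 + 1))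
    rw [pow_zero, one_smul]
    exact h0
  · rw [hV, hV]
    exact hscale _ _ (2 * (n + 1)) (pow_succ _ _)

theorem IsSchurAlgorithm.transfer_zeta (hΓ : Γ.IsSchurAlgorithm Θ Θs) {z : ℂ}
    (hz : z ∈ Metric.ball (0 : ℂ) 1) (k : ℕ) : (Γ.zeta k).transfer z = Θs k z := by
  ext u
  obtain ⟨h, hh⟩ := hΓ.exists_zeta_op_eq hz k u
  exact LinearSystem.transfer_apply_of_op_eq (Γ.isUnitaryOp_zeta k) (mem_ball_zero_iff.1 hz) hh

theorem IsSchurAlgorithm.transfer_zetat (hΓ : Γ.IsSchurAlgorithm Θ Θs) {z : ℂ}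
    (hz : z ∈ Metric.ball (0 : ℂ) 1) (k : ℕ) : (Γ.zetat k).transfer z = Θs k z := by
  ext u
  obtain ⟨h, hh⟩ := hΓ.exists_zeta_op_eq hz k u
  refine LinearSystem.transfer_apply_of_op_eq (h := Γ.opV k h) (Γ.isUnitaryOp_zetat k)
    (mem_ball_zero_iff.1 hz) ?_
  rw [← map_smul, zetat_op_opV, hh, opMt_apply]

end ChoiceSequence

end BlockCMV

end

theorem theorem5p3 {M N : Type*}
    [NormedAddCommGroup M] [InnerProductSpace ℂ M] [CompleteSpace M]
    [NormedAddCommGroup N] [InnerProductSpace ℂ N] [CompleteSpace N]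
    (Θ : ℂ → M →L[ℂ] N) (hΘ : BlockCMV.IsSchur Θ)
    (Γ : BlockCMV.ChoiceSequence M N) (Θs : ∀ n, ℂ → Γ.E n →L[ℂ] Γ.F n)
    (hΓ : Γ.IsSchurAlgorithm Θ Θs) :
    ((Γ.zeta 0).IsConservative ∧ (Γ.zeta 0).IsSimple ∧
      ∀ z ∈ Metric.ball (0 : ℂ) 1, (Γ.zeta 0).transfer z = Θ z) ∧
    ((Γ.zetat 0).IsConservative ∧ (Γ.zetat 0).IsSimple ∧
      ∀ z ∈ Metric.ball (0 : ℂ) 1, (Γ.zetat 0).transfer z = Θ z) ∧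
    ∀ k : ℕ,
      ((Γ.zeta k).IsConservative ∧ (Γ.zeta k).IsSimple ∧
        ∀ z ∈ Metric.ball (0 : ℂ) 1, (Γ.zeta k).transfer z = Θs k z) ∧
      ((Γ.zetat k).IsConservative ∧ (Γ.zetat k).IsSimple ∧
        ∀ z ∈ Metric.ball (0 : ℂ) 1, (Γ.zetat k).transfer z = Θs k z) :=
  ⟨⟨Γ.isConservative_zeta 0, Γ.isSimple_zeta 0,
      fun z hz => (hΓ.transfer_zeta hz 0).trans (hΓ.zero z hz)⟩,
    ⟨Γ.isConservative_zetat 0, Γ.isSimple_zetat 0,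
      fun z hz => (hΓ.transfer_zetat hz 0).trans (hΓ.zero z hz)⟩,
    fun k => ⟨⟨Γ.isConservative_zeta k, Γ.isSimple_zeta k, fun _ hz => hΓ.transfer_zeta hz k⟩,
      ⟨Γ.isConservative_zetat k, Γ.isSimple_zetat k, fun _ hz => hΓ.transfer_zetat hz k⟩⟩⟩
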